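/- Let $1\le s\le n$ be integers, let $C\in\mathbb{R}^{n\times n}$ be symmetric positive definite with smallest eigenvalue $\lambda_{\min}(C)$, and let $$z^*=\max\{\log\det C_{S,S}: S\subseteq\{1,\dots,n\},\ |S|=s\}$$ be the optimal value of the maximum-entropy sampling problem (MESP), where $C_{S,S}$ is the principal submatrix of $C$ indexed by $S$. Let $0\le t\le\lambda_{\min}(C)$, let $A\in\mathbb{R}^{n\times n}$ be any matrix with $C-tI=A^{\top}A$, with columns $a_1,\dots,a_n$, and put $\mathcal{M}_t(x)=\sum_{i=1}^n x_i a_i a_i^{\top}$ for $x\in[0,1]^n$. For a symmetric positive semidefinite $n\times n$ matrix $X$ with eigenvalues $\lambda_1(X)\ge\dots\ge\lambda_n(X)$ let $\Phi_s(X;t)=\sum_{i=1}^s\log(\lambda_i(X)+t)\in[-\infty,\infty)$, where $\log 0=-\infty$, and let $\widehat\Phi_s(\cdot\,;t)$ be the concave envelope of $\Phi_s(\cdot\,;t)$ on the cone of symmetric positive semidefinite matrices, i.e. the pointwise infimum of all extended-real-valued concave functions on this cone that lie above $\Phi_s(\cdot\,;t)$. Then MESP is equivalent to a concave integer program: $$z^*=\max\Big\{\widehat\Phi_s(\mathcal{M}_t(x);t):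 x\in\{0,1\}^n,\ \sum_{i=1}^n x_i=s\Big\},$$ both maxima are attained and finite, and $\widehat\Phi_s(\mathcal{M}_t(x);t)=\log\det C_{S,S}$ whenever $x$ is the characteristic vector of a set $S$ with $|S|=s$. Moreover $\widehat\Phi_s(\mathcal{M}_t(x);t)=\Phi_s(\mathcal{M}_t(x);t)$ for every $x\in\{0,1\}^n$ with $\sum_i x_i=s$, and $x\mapsto\widehat\Phi_s(\mathcal{M}_t(x);t)$ is a concave function on $[0,1]^n$ with values in $[-\infty,\infty)$. -/

import Mathlib

namespace MESP

/-- Concavity of an extended-real-valued function `f` on a set `S` of a real vector space: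
`S` is convex and the hypograph of `f` over `S` is convex. -/
def EConcaveOn {E : Type*} [AddCommGroup E] [Module ℝ E] (S : Set E) (f : E → EReal) : Prop :=
  Convex ℝ S ∧ Convex ℝ {p : E × ℝ | p.1 ∈ S ∧ (p.2 : EReal) ≤ f p.1}

/-- The concave envelope of `f` on `S`: the pointwise infimum of all functions that are concave
on `S` and lie above `f` on `S`. -/
noncomputable def concaveEnvelope {E : Type*} [AddCommGroup E] [Module ℝ E]
    (S : Set E) (f : E → EReal) (x : E) : EReal :=
  sInf {v : EReal | ∃ g : E → EReal, EConcaveOn S g ∧ (∀ y ∈ S, f y ≤ g y) ∧ v = g x}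

/-- The cone of real symmetric positive semidefinite `n × n` matrices. -/
def psdCone (n : ℕ) : Set (Matrix (Fin n) (Fin n) ℝ) := {X | X.PosSemidef}

/-- The eigenvalues of a symmetric matrix, with multiplicity, in nonincreasing order
(and `0` for a matrix that is not symmetric). -/
noncomputable def eigvals {n : ℕ} (X : Matrix (Fin n) (Fin n) ℝ) (i : Fin n) : ℝ :=
  if h : X.IsHermitian then h.eigenvalues₀ (Fin.cast (Fintype.card_fin n).symm i) else 0

/-- The smallest eigenvalue of a symmetric matrix (of size at least one). -/
noncomputable def minEigval {n : ℕ} (X : Matrix (Fin n) (Fin n) ℝ) : ℝ := ⨅ i, eigvals X i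

/-- `Φ_s(X; t)`, the sum of `log (λ_i(X) + t)` over the `s` largest eigenvalues of `X`, where
`log 0 = -∞`. -/
noncomputable def Phi {n : ℕ} (s : ℕ) (t : ℝ) (X : Matrix (Fin n) (Fin n) ℝ) : EReal :=
  ∑ i : Fin n with i.val < s, ENNReal.log (ENNReal.ofReal (eigvals X i + t))

/-- The concave envelope of `Φ_s(· ; t)` on the positive semidefinite cone. -/
noncomputable def PhiHat {n : ℕ} (s : ℕ) (t : ℝ) (X : Matrix (Fin n) (Fin n) ℝ) : EReal :=
  concaveEnvelope (psdCone n) (Phi s t) X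

/-- `∑ i, x_i a_i a_iᵀ`, where `a_i` is the `i`-th column of `A`. -/
noncomputable def M {n : ℕ} (A : Matrix (Fin n) (Fin n) ℝ) (x : Fin n → ℝ) :
    Matrix (Fin n) (Fin n) ℝ :=
  ∑ i, x i • Matrix.vecMulVec (fun j => A j i) (fun j => A j i)

/-- The objective of the maximum-entropy sampling problem: the log-determinant of the principal
submatrix of `C` indexed by `S`. -/
noncomputable def logDetSub {n : ℕ} (C : Matrix (Fin n) (Fin n) ℝ) (S : Finset (Fin n)) : ℝ :=
  Real.log (C.submatrix (fun i : S => (i : Fin n)) (fun i : S => (i : Fin n))).det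

/-- The binary vectors with exactly `s` ones. -/
def feasible (n s : ℕ) : Set (Fin n → ℝ) :=
  {x | (∀ i, x i = 0 ∨ x i = 1) ∧ ∑ i, x i = (s : ℝ)}

end MESP

namespace MESP

open Matrix Finset

/-! At the indicator of `S`, `M A x = B * Bᵀ` with `B` the columns of `A` in `S`, and `Bᵀ * B = C_SS
- t I` has the same nonzero spectrum. So `det C_SS` is the product of the top `s` values `λ_i + t`,
and the remaining eigenvalues vanish.

The envelope adds nothing at such a matrix `X₀`, since an affine function majorizes `Phi` and
touches it there (`exists_affine_majorant`). Its gradient shares the eigenvectors of `X₀`, with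
eigenvalues `1/(λ_i + t)` for the top `s` and `1/(λ_s + t)` for the rest. Majorization is the
tangent bound for `log`, averaged over the squared entries of an orthogonal matrix
(`sum_log_add_le`). The same majorant keeps the envelope below `⊤`. -/

/-- The tangent-line bound, averaged over a doubly stochastic matrix, behind the affine majorant
of `Phi`. -/
theorem sum_log_add_le {n s : ℕ} {t β : ℝ} (μ η : Fin n → ℝ) (P : Fin n → Fin n → ℝ)
    (hμ : ∀ i, 0 ≤ μ i) (hμt : ∀ i : Fin n, i.val < s → 0 < μ i + t)
    (hβ : 0 < β) (hβt : t * β ≤ 1) (hη : ∀ i, 0 < η i) (hηβ : ∀ i, η i ≤ β)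
    (hη' : ∀ i : Fin n, ¬ i.val < s → η i = β)
    (hP : ∀ i j, 0 ≤ P i j) (hrow : ∀ i, ∑ j, P i j = 1) (hcol : ∀ j, ∑ i, P i j = 1) :
    ∑ i : Fin n with i.val < s, Real.log (μ i + t) ≤
      (∑ i, ∑ j, P i j * (η j * μ i)) +
        ∑ j : Fin n with j.val < s, (t * η j - 1 - Real.log (η j)) := by
  set h : Fin n → ℝ := fun j => t * η j - 1 - Real.log (η j) with h_def
  set k : ℝ := t * β - 1 - Real.log β with hk
  have tangent : ∀ i j : Fin n, i.val < s → Real.log (μ i + t) ≤ η j * μ i + h j := by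
    intro i j hi
    have := Real.log_le_sub_one_of_pos (mul_pos (hη j) (hμt i hi))
    rw [Real.log_mul (hη j).ne' (hμt i hi).ne'] at this
    simp only [h_def]
    linarith
  -- `η ↦ t η - log η` is nonincreasing while `t η ≤ 1`, hence up to `β`.
  have hk_le : ∀ j, k ≤ h j := by
    intro j
    have h1 := Real.log_le_sub_one_of_pos (div_pos (hη j) hβ)
    rw [Real.log_div (hη j).ne' hβ.ne'] at h1
    have h2 : t * (β - η j) ≤ 1 - η j / β := by
      have : 1 - η j / β = (β - η j) / β := by field_simp
      rw [this, le_div_iff₀ hβ]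
      nlinarith [hηβ j]
    simp only [h_def, hk]
    linarith
  have hk_eq : ∀ j : Fin n, ¬ j.val < s → h j = k := by
    intro j hj
    simp only [h_def, hk, hη' j hj]
  have h1 : ∀ i : Fin n, i.val < s →
      Real.log (μ i + t) ≤ (∑ j, P i j * (η j * μ i)) + ∑ j, P i j * h j := by
    intro i hi
    calc Real.log (μ i + t) = ∑ j, P i j * Real.log (μ i + t) := by
          rw [← Finset.sum_mul, hrow, one_mul]
      _ ≤ ∑ j, P i j * (η j * μ i + h j) :=
          Finset.sum_le_sum fun j _ => mul_le_mul_of_nonneg_left (tangent i j hi) (hP i j)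
      _ = _ := by rw [← Finset.sum_add_distrib]; simp only [mul_add]
  have h2 : ∑ i : Fin n with i.val < s, ∑ j, P i j * (η j * μ i) ≤
      ∑ i, ∑ j, P i j * (η j * μ i) :=
    Finset.sum_le_sum_of_subset_of_nonneg (Finset.filter_subset _ _) fun i _ _ =>
      Finset.sum_nonneg fun j _ => mul_nonneg (hP i j) (mul_nonneg (hη j).le (hμ i))
  -- The excess `h j - k` is nonnegative and vanishes for `j ≥ s`; the first `s` rows give each
  -- column weight at most one.
  have h3 : ∑ i : Fin n with i.val < s, ∑ j, P i j * (h j - k) ≤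
      ∑ j : Fin n with j.val < s, (h j - k) := by
    rw [Finset.sum_comm, Finset.sum_filter]
    refine Finset.sum_le_sum fun j _ => ?_
    rw [← Finset.sum_mul]
    split_ifs with hj
    · refine mul_le_of_le_one_left (sub_nonneg.2 (hk_le j)) ?_
      rw [← hcol j]
      exact Finset.sum_le_sum_of_subset_of_nonneg (Finset.filter_subset _ _) fun i _ _ => hP i j
    · rw [hk_eq j hj, sub_self, mul_zero]
  have h4 : ∑ i : Fin n with i.val < s, ∑ j, P i j * (h j - k) =
      (∑ i : Fin n with i.val < s, ∑ j, P i j * h j) - ∑ i : Fin n with i.val < s, k := by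
    rw [← Finset.sum_sub_distrib]
    refine Finset.sum_congr rfl fun i _ => ?_
    simp only [mul_sub, Finset.sum_sub_distrib]
    rw [← Finset.sum_mul, hrow, one_mul]
  rw [h4, Finset.sum_sub_distrib (f := h) (g := fun _ => k)] at h3
  calc ∑ i : Fin n with i.val < s, Real.log (μ i + t)
      ≤ ∑ i : Fin n with i.val < s, ((∑ j, P i j * (η j * μ i)) + ∑ j, P i j * h j) :=
        Finset.sum_le_sum fun i hi => h1 i (Finset.mem_filter.1 hi).2
    _ ≤ _ := by rw [Finset.sum_add_distrib]; linarith

/-! ### Ordered eigenvalues and diagonalization -/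

theorem eigvals_antitone {n : ℕ} {X : Matrix (Fin n) (Fin n) ℝ} (hX : X.IsHermitian) :
    Antitone (eigvals X) := by
  intro i j hij
  simp only [eigvals, dif_pos hX]
  exact hX.eigenvalues₀_antitone (by simpa using hij)

/-- `eigenvalues` is indexed through a chosen bijection, so it need not be sorted; `e` translates to
the sorted order. -/
theorem exists_equiv_eigvals {n : ℕ} {X : Matrix (Fin n) (Fin n) ℝ} (hX : X.IsHermitian) :
    ∃ e : Fin n ≃ Fin n, ∀ i, eigvals X (e i) = hX.eigenvalues i := by
  refine ⟨(Fintype.equivOfCardEq (Fintype.card_fin _)).symm.trans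
    (finCongr (Fintype.card_fin n)), fun i => ?_⟩
  simp only [eigvals, dif_pos hX, IsHermitian.eigenvalues]
  congr 1

theorem eigvals_nonneg {n : ℕ} {X : Matrix (Fin n) (Fin n) ℝ} (hX : X.PosSemidef) (i : Fin n) :
    0 ≤ eigvals X i := by
  obtain ⟨e, he⟩ := exists_equiv_eigvals hX.isHermitian
  rw [← e.apply_symm_apply i, he]
  exact hX.eigenvalues_nonneg _

/-- Orthogonal diagonalization with the eigenvalues in the order of `eigvals`. -/
theorem exists_diagonalization {n : ℕ} {X : Matrix (Fin n) (Fin n) ℝ} (hX : X.IsHermitian) :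
    ∃ U : Matrix (Fin n) (Fin n) ℝ, Uᵀ * U = 1 ∧ U * Uᵀ = 1 ∧
      X = U * diagonal (eigvals X) * Uᵀ := by
  obtain ⟨e, he⟩ := exists_equiv_eigvals hX
  set V : Matrix (Fin n) (Fin n) ℝ := hX.eigenvectorUnitary.1 with hV
  have hs : star V = Vᵀ := by
    rw [star_eq_conjTranspose, conjTranspose_eq_transpose_of_trivial]
  have h1 : Vᵀ * V = 1 := by
    rw [← hs]; exact Unitary.coe_star_mul_self _
  have h2 : V * Vᵀ = 1 := by
    rw [← hs]; exact Unitary.coe_mul_star_self _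
  have h3 : X = V * diagonal hX.eigenvalues * Vᵀ := by
    have := hX.spectral_theorem
    rw [Unitary.conjStarAlgAut_apply] at this
    rw [← hs]
    exact this
  refine ⟨V.submatrix id e.symm, ?_, ?_, ?_⟩
  · rw [transpose_submatrix, submatrix_mul _ _ _ id _ Function.bijective_id |>.symm, h1]
    simp
  · rw [transpose_submatrix, submatrix_mul_equiv, h2]
    simp
  · have hd : diagonal (eigvals X) = (diagonal hX.eigenvalues).submatrix e.symm e.symm := by
      rw [submatrix_diagonal _ _ e.symm.injective]
      congr 1
      ext i
      simp [← he]
    rw [hd, transpose_submatrix, submatrix_mul_equiv, submatrix_mul_equiv, ← h3]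
    simp

/-! ### Extended-real values and concave envelopes -/

theorem Phi_eq_coe {n s : ℕ} {t : ℝ} {X : Matrix (Fin n) (Fin n) ℝ}
    (h : ∀ i : Fin n, i.val < s → 0 < eigvals X i + t) :
    Phi s t X = ((∑ i : Fin n with i.val < s, Real.log (eigvals X i + t) : ℝ) : EReal) := by
  rw [Phi, Finset.sum_congr rfl fun i hi =>
    ENNReal.log_ofReal_of_pos (h i (Finset.mem_filter.1 hi).2)]
  exact (map_sum (⟨⟨Real.toEReal, EReal.coe_zero⟩, EReal.coe_add⟩ : ℝ →+ EReal) _ _).symm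

theorem Phi_eq_bot {n s : ℕ} {t : ℝ} {X : Matrix (Fin n) (Fin n) ℝ} {i : Fin n}
    (hi : i.val < s) (h : eigvals X i + t ≤ 0) : Phi s t X = ⊥ := by
  rw [Phi, ← Finset.add_sum_erase _ _ (Finset.mem_filter.2 ⟨Finset.mem_univ i, hi⟩),
    ENNReal.ofReal_of_nonpos h, ENNReal.log_zero, EReal.bot_add]

theorem EConcaveOn.coe_add_linearMap {E : Type*} [AddCommGroup E] [Module ℝ E] {S : Set E}
    (hS : Convex ℝ S) (c : ℝ) (f : E →ₗ[ℝ] ℝ) :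
    EConcaveOn S (fun x => ((c + f x : ℝ) : EReal)) := by
  refine ⟨hS, ?_⟩
  rintro ⟨x, a⟩ ⟨hx, ha⟩ ⟨y, b⟩ ⟨hy, hb⟩ p q hp hq hpq
  refine ⟨hS hx hy hp hq hpq, ?_⟩
  simp only [EReal.coe_le_coe_iff] at ha hb ⊢
  simp only [Prod.smul_mk, Prod.mk_add_mk, map_add, map_smul, smul_eq_mul]
  have hc : c = p * c + q * c := by rw [← add_mul, hpq, one_mul]
  nlinarith [mul_le_mul_of_nonneg_left ha hp, mul_le_mul_of_nonneg_left hb hq]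

/-- The hypograph of an infimum is the intersection of the hypographs. -/
theorem EConcaveOn.concaveEnvelope {E : Type*} [AddCommGroup E] [Module ℝ E] {S : Set E}
    (hS : Convex ℝ S) (f : E → EReal) : EConcaveOn S (concaveEnvelope S f) := by
  refine ⟨hS, ?_⟩
  rintro ⟨x, a⟩ ⟨hx, ha⟩ ⟨y, b⟩ ⟨hy, hb⟩ p q hp hq hpq
  refine ⟨hS hx hy hp hq hpq, le_sInf ?_⟩
  rintro _ ⟨g, hg, hfg, rfl⟩
  exact (hg.2 (x := (x, a)) ⟨hx, ha.trans (sInf_le ⟨g, hg, hfg, rfl⟩)⟩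
    (y := (y, b)) ⟨hy, hb.trans (sInf_le ⟨g, hg, hfg, rfl⟩)⟩ hp hq hpq).2

theorem EConcaveOn.comp_linearMap {E F : Type*} [AddCommGroup E] [Module ℝ E]
    [AddCommGroup F] [Module ℝ F] {S : Set E} {T : Set F} {f : E → EReal} (hf : EConcaveOn S f)
    (hT : Convex ℝ T) (L : F →ₗ[ℝ] E) (hL : ∀ x ∈ T, L x ∈ S) :
    EConcaveOn T (fun x => f (L x)) := by
  refine ⟨hT, ?_⟩
  rintro ⟨x, a⟩ ⟨hx, ha⟩ ⟨y, b⟩ ⟨hy, hb⟩ p q hp hq hpq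
  refine ⟨hT hx hy hp hq hpq, ?_⟩
  have := (hf.2 (x := (L x, a)) ⟨hL x hx, ha⟩ (y := (L y, b)) ⟨hL y hy, hb⟩ hp hq hpq).2
  simpa using this

theorem le_concaveEnvelope {E : Type*} [AddCommGroup E] [Module ℝ E] {S : Set E} (f : E → EReal)
    {x : E} (hx : x ∈ S) : f x ≤ concaveEnvelope S f x := by
  refine le_sInf ?_
  rintro _ ⟨g, -, hfg, rfl⟩
  exact hfg x hx

theorem convex_psdCone (n : ℕ) : Convex ℝ (psdCone n) := by
  intro X hX Y hY p q hp hq _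
  exact (PosSemidef.smul hX hp).add (PosSemidef.smul hY hq)

/-- At a positive semidefinite matrix of rank at most `s`, the function `Phi` has an affine
majorant on the positive semidefinite cone that touches it there. -/
theorem exists_affine_majorant {n s : ℕ} (hs : 1 ≤ s) (hsn : s ≤ n) {t : ℝ}
    {X₀ : Matrix (Fin n) (Fin n) ℝ} (hX₀ : X₀.PosSemidef)
    (hpos : ∀ i : Fin n, i.val < s → 0 < eigvals X₀ i + t)
    (hzero : ∀ i : Fin n, ¬ i.val < s → eigvals X₀ i = 0) :
    ∃ (c : ℝ) (f : Matrix (Fin n) (Fin n) ℝ →ₗ[ℝ] ℝ),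
      (∀ X ∈ psdCone n, Phi s t X ≤ ((c + f X : ℝ) : EReal)) ∧
      ((c + f X₀ : ℝ) : EReal) = Phi s t X₀ := by
  obtain ⟨V, hV, hV', hX₀V⟩ := exists_diagonalization hX₀.isHermitian
  set l : Fin n := ⟨s - 1, by omega⟩ with hl
  have hls : l.val < s := by simp [hl]; omega
  set β : ℝ := (eigvals X₀ l + t)⁻¹ with hβ_def
  have hβ : 0 < β := inv_pos.2 (hpos l hls)
  have hβt : t * β ≤ 1 := by
    rw [hβ_def, ← div_eq_mul_inv, div_le_one (hpos l hls)]
    linarith [eigvals_nonneg hX₀ l]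
  -- Slopes of `log (· + t)` at the top `s` eigenvalues, continued by the largest of them. The
  -- continuation costs nothing at `X₀`, whose other eigenvalues are zero.
  set η : Fin n → ℝ := fun i => if i.val < s then (eigvals X₀ i + t)⁻¹ else β with hη_def
  have hη_lt : ∀ i : Fin n, i.val < s → η i = (eigvals X₀ i + t)⁻¹ := fun i hi => by
    simp only [hη_def, if_pos hi]
  have hη_ge : ∀ i : Fin n, ¬ i.val < s → η i = β := fun i hi => by
    simp only [hη_def, if_neg hi]
  have hη : ∀ i, 0 < η i := by
    intro i
    by_cases hi : i.val < s
    · rw [hη_lt i hi]; exact inv_pos.2 (hpos i hi)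
    · rw [hη_ge i hi]; exact hβ
  have hηβ : ∀ i, η i ≤ β := by
    intro i
    by_cases hi : i.val < s
    · rw [hη_lt i hi, hβ_def]
      have hil : i ≤ l := by rw [Fin.le_def]; simp only [hl]; omega
      exact inv_anti₀ (hpos l hls) (by linarith [eigvals_antitone hX₀.isHermitian hil])
    · rw [hη_ge i hi]
  refine ⟨∑ j : Fin n with j.val < s, (t * η j - 1 - Real.log (η j)),
    (traceLinearMap (Fin n) ℝ ℝ) ∘ₗ
      (LinearMap.mulLeft ℝ (V * diagonal η * Vᵀ)), ?_, ?_⟩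
  · intro X hX
    by_cases hXt : ∀ i : Fin n, i.val < s → 0 < eigvals X i + t
    swap
    · push Not at hXt
      obtain ⟨i, hi, hi'⟩ := hXt
      rw [Phi_eq_bot hi hi']
      exact bot_le
    rw [Phi_eq_coe hXt, EReal.coe_le_coe_iff]
    obtain ⟨U, hU, hU', hXU⟩ := exists_diagonalization (PosSemidef.isHermitian hX)
    -- `W` is orthogonal, so its squared entries form a doubly stochastic matrix.
    set W := Uᵀ * V with hW
    have hWW : W * Wᵀ = 1 := by
      rw [hW, transpose_mul, transpose_transpose, Matrix.mul_assoc, ← Matrix.mul_assoc V, hV',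
        Matrix.one_mul, hU]
    have hWW' : Wᵀ * W = 1 := by
      rw [hW, transpose_mul, transpose_transpose, Matrix.mul_assoc, ← Matrix.mul_assoc U, hU',
        Matrix.one_mul, hV]
    have key := sum_log_add_le (eigvals X) η (fun i j => W i j ^ 2) (eigvals_nonneg hX) hXt
      hβ hβt hη hηβ hη_ge (fun i j => sq_nonneg _)
      (fun i => by
        have := congrFun (congrFun hWW i) i
        simpa [Matrix.mul_apply, sq] using this)
      (fun j => by
        have := congrFun (congrFun hWW' j) j
        simpa [Matrix.mul_apply, sq] using this)
    refine key.trans_eq ?_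
    rw [add_comm]
    congr 1
    simp only [LinearMap.comp_apply, LinearMap.mulLeft_apply, traceLinearMap_apply]
    have h1 : (V * diagonal η * Vᵀ * X).trace =
        (W * diagonal η * Wᵀ * diagonal (eigvals X)).trace := by
      conv_lhs => rw [hXU]
      rw [← Matrix.mul_assoc, trace_mul_comm, hW, transpose_mul, transpose_transpose]
      simp only [Matrix.mul_assoc]
    rw [h1, trace]
    refine Finset.sum_congr rfl fun i _ => ?_
    rw [diag_apply, mul_diagonal, Matrix.mul_apply, Finset.sum_mul]
    refine Finset.sum_congr rfl fun j _ => ?_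
    rw [mul_diagonal, transpose_apply]
    ring
  · rw [Phi_eq_coe hpos, EReal.coe_eq_coe_iff]
    simp only [LinearMap.comp_apply, LinearMap.mulLeft_apply, traceLinearMap_apply]
    have h1 : (V * diagonal η * Vᵀ * X₀).trace = ∑ i : Fin n with i.val < s, η i * eigvals X₀ i := by
      conv_lhs => rw [hX₀V]
      rw [← Matrix.mul_assoc, trace_mul_comm, ← Matrix.mul_assoc, ← Matrix.mul_assoc,
        ← Matrix.mul_assoc, ← Matrix.mul_assoc, hV, Matrix.one_mul, Matrix.mul_assoc (diagonal η),
        hV, Matrix.mul_one,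
        diagonal_mul_diagonal, trace_diagonal, Finset.sum_filter]
      refine Finset.sum_congr rfl fun i _ => ?_
      split_ifs with hi
      · rfl
      · rw [hzero i hi, mul_zero]
    rw [h1, ← Finset.sum_add_distrib]
    refine Finset.sum_congr rfl fun i hi => ?_
    have hi := (Finset.mem_filter.1 hi).2
    have := (hpos i hi).ne'
    rw [hη_lt i hi, Real.log_inv]
    field_simp
    ring

theorem PhiHat_eq_Phi {n s : ℕ} (hs : 1 ≤ s) (hsn : s ≤ n) {t : ℝ}
    {X₀ : Matrix (Fin n) (Fin n) ℝ} (hX₀ : X₀.PosSemidef)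
    (hpos : ∀ i : Fin n, i.val < s → 0 < eigvals X₀ i + t)
    (hzero : ∀ i : Fin n, ¬ i.val < s → eigvals X₀ i = 0) :
    PhiHat s t X₀ = Phi s t X₀ := by
  obtain ⟨c, f, hle, heq⟩ := exists_affine_majorant hs hsn hX₀ hpos hzero
  refine le_antisymm ?_ (le_concaveEnvelope _ hX₀)
  rw [← heq]
  exact sInf_le ⟨_, EConcaveOn.coe_add_linearMap (convex_psdCone n) c f, hle, rfl⟩

/-- A single touching point `X₀` suffices: its affine majorant is finite at every `X`. -/
theorem PhiHat_ne_top {n s : ℕ} (hs : 1 ≤ s) (hsn : s ≤ n) {t : ℝ}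
    {X₀ : Matrix (Fin n) (Fin n) ℝ} (hX₀ : X₀.PosSemidef)
    (hpos : ∀ i : Fin n, i.val < s → 0 < eigvals X₀ i + t)
    (hzero : ∀ i : Fin n, ¬ i.val < s → eigvals X₀ i = 0) (X : Matrix (Fin n) (Fin n) ℝ) :
    PhiHat s t X ≠ ⊤ := by
  obtain ⟨c, f, hle, -⟩ := exists_affine_majorant hs hsn hX₀ hpos hzero
  exact ne_top_of_le_ne_top (EReal.coe_ne_top _)
    (sInf_le ⟨_, EConcaveOn.coe_add_linearMap (convex_psdCone n) c f, hle, rfl⟩)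

/-! ### Spectra of Gram matrices -/

section Gram

variable {n : ℕ} {ι : Type*} [Fintype ι]

theorem posSemidef_mul_transpose (B : Matrix (Fin n) ι ℝ) : (B * Bᵀ).PosSemidef := by
  simpa only [conjTranspose_eq_transpose_of_trivial] using posSemidef_self_mul_conjTranspose B

theorem eigvals_mul_transpose_eq_zero (B : Matrix (Fin n) ι ℝ) {i : Fin n}
    (hi : ¬ i.val < Fintype.card ι) : eigvals (B * Bᵀ) i = 0 := by
  have hB := posSemidef_mul_transpose B
  by_contra h
  have hi_pos : 0 < eigvals (B * Bᵀ) i := lt_of_le_of_ne (eigvals_nonneg hB i) (Ne.symm h)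
  obtain ⟨e, he⟩ := exists_equiv_eigvals hB.isHermitian
  have hrank : (B * Bᵀ).rank ≤ Fintype.card ι :=
    (rank_mul_le_left _ _).trans (rank_le_card_width _)
  rw [hB.isHermitian.rank_eq_card_non_zero_eigs, Fintype.card_subtype] at hrank
  -- By the ordering, a positive eigenvalue at `i` forces `i + 1` nonzero eigenvalues, more than the
  -- rank allows.
  have hsub : (Finset.Iic i).map e.symm.toEmbedding ⊆
      Finset.univ.filter fun j => hB.isHermitian.eigenvalues j ≠ 0 := by
    intro j hj
    obtain ⟨k, hk, rfl⟩ := Finset.mem_map.1 hj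
    refine Finset.mem_filter.2 ⟨Finset.mem_univ _, ?_⟩
    rw [← he]
    simp only [Equiv.coe_toEmbedding, Equiv.apply_symm_apply]
    exact (hi_pos.trans_le (eigvals_antitone hB.isHermitian (Finset.mem_Iic.1 hk))).ne'
  have := (Finset.card_le_card hsub).trans hrank
  rw [Finset.card_map, Fin.card_Iic] at this
  omega

/-- The characteristic polynomials of `B * Bᵀ` and `Bᵀ * B` differ by a power of `X`; cancel it and
evaluate at `-t`. -/
theorem det_transpose_mul_add_smul_one [DecidableEq ι] (B : Matrix (Fin n) ι ℝ)
    (hn : Fintype.card ι ≤ n) (t : ℝ) :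
    (Bᵀ * B + t • (1 : Matrix ι ι ℝ)).det =
      ∏ i : Fin n with i.val < Fintype.card ι, (eigvals (B * Bᵀ) i + t) := by
  have hB := posSemidef_mul_transpose B
  obtain ⟨e, he⟩ := exists_equiv_eigvals hB.isHermitian
  have h1 : (B * Bᵀ).charpoly =
      ∏ i : Fin n, (Polynomial.X - Polynomial.C (eigvals (B * Bᵀ) i)) := by
    rw [hB.isHermitian.charpoly_eq,
      ← Equiv.prod_comp e fun i => Polynomial.X - Polynomial.C (eigvals (B * Bᵀ) i)]
    simp [he]
  have hcard : (Finset.univ.filter fun i : Fin n => ¬ i.val < Fintype.card ι).card =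
      n - Fintype.card ι := by
    have h := Finset.card_filter_add_card_filter_not (s := (Finset.univ : Finset (Fin n)))
      (fun i => i.val < Fintype.card ι)
    rw [Fin.card_filter_val_lt, Finset.card_univ, Fintype.card_fin, min_eq_right hn] at h
    omega
  have h2 : (B * Bᵀ).charpoly = Polynomial.X ^ (n - Fintype.card ι) *
      ∏ i : Fin n with i.val < Fintype.card ι,
        (Polynomial.X - Polynomial.C (eigvals (B * Bᵀ) i)) := by
    rw [h1, ← Finset.prod_filter_mul_prod_filter_not _ (fun i : Fin n => i.val < Fintype.card ι),
      mul_comm, Finset.prod_congr rfl (fun i hi => by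
        rw [eigvals_mul_transpose_eq_zero B (Finset.mem_filter.1 hi).2, map_zero, sub_zero]),
      Finset.prod_const, hcard]
  have h3 := charpoly_mul_comm_of_le B Bᵀ (by simpa using hn)
  rw [h2, Fintype.card_fin] at h3
  have h4 := mul_left_cancel₀ (pow_ne_zero _ Polynomial.X_ne_zero) h3
  have h5 := congrArg (Polynomial.eval (-t)) h4
  rw [eval_charpoly, Polynomial.eval_prod] at h5
  have h6 : scalar ι (-t) - Bᵀ * B = -(Bᵀ * B + t • (1 : Matrix ι ι ℝ)) := by
    rw [scalar_apply, ← smul_one_eq_diagonal, neg_smul]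
    abel
  have h7 : ∀ i : Fin n, Polynomial.eval (-t)
      (Polynomial.X - Polynomial.C (eigvals (B * Bᵀ) i)) = -1 * (eigvals (B * Bᵀ) i + t) := by
    intro i
    simp only [Polynomial.eval_sub, Polynomial.eval_X, Polynomial.eval_C]
    ring
  rw [h6, det_neg, Finset.prod_congr rfl fun i _ => h7 i, Finset.prod_mul_distrib,
    Finset.prod_const, Fin.card_filter_val_lt, min_eq_right hn] at h5
  exact (mul_left_cancel₀ (pow_ne_zero _ (by norm_num)) h5).symm

end Gram

/-! ### The matrices `M A x` and binary points -/

theorem M_eq {n : ℕ} (A : Matrix (Fin n) (Fin n) ℝ) (x : Fin n → ℝ) :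
    M A x = A * diagonal x * Aᵀ := by
  ext j k
  rw [M, Matrix.sum_apply, Matrix.mul_apply]
  refine Finset.sum_congr rfl fun i _ => ?_
  rw [mul_diagonal, Matrix.smul_apply, vecMulVec_apply, transpose_apply, smul_eq_mul]
  ring

/-- The map `M A` as a linear map. -/
noncomputable def linearM {n : ℕ} (A : Matrix (Fin n) (Fin n) ℝ) :
    (Fin n → ℝ) →ₗ[ℝ] Matrix (Fin n) (Fin n) ℝ where
  toFun := M A
  map_add' x y := by simp only [M, Pi.add_apply, add_smul, Finset.sum_add_distrib]
  map_smul' c x := by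
    simp only [M, Pi.smul_apply, smul_eq_mul, mul_smul, Finset.smul_sum, RingHom.id_apply]

theorem posSemidef_M {n : ℕ} (A : Matrix (Fin n) (Fin n) ℝ) {x : Fin n → ℝ} (hx : 0 ≤ x) :
    (M A x).PosSemidef := by
  rw [M_eq]
  simpa only [conjTranspose_eq_transpose_of_trivial] using
    (PosSemidef.diagonal hx).mul_mul_conjTranspose_same A

theorem M_indicator {n : ℕ} (A : Matrix (Fin n) (Fin n) ℝ) (S : Finset (Fin n)) :
    M A (fun i => if i ∈ S then 1 else 0) =
      A.submatrix id ((↑) : S → Fin n) * (A.submatrix id ((↑) : S → Fin n))ᵀ := by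
  ext j k
  rw [M, Matrix.sum_apply, Matrix.mul_apply]
  simp only [Matrix.smul_apply, vecMulVec_apply, smul_eq_mul, ite_mul, one_mul, zero_mul,
    submatrix_apply, transpose_apply, id]
  rw [Finset.sum_ite_mem, Finset.univ_inter, ← Finset.sum_coe_sort]

theorem mem_feasible_iff {n s : ℕ} {x : Fin n → ℝ} :
    x ∈ feasible n s ↔ ∃ S : Finset (Fin n), S.card = s ∧ x = fun i => if i ∈ S then 1 else 0 := by
  constructor
  · rintro ⟨h01, hsum⟩
    have hx : x = fun i => if i ∈ Finset.univ.filter (fun i => x i = 1) then 1 else 0 := by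
      ext i
      rcases h01 i with h | h <;> simp [h]
    refine ⟨_, ?_, hx⟩
    rw [hx] at hsum
    rw [Finset.sum_ite_mem, Finset.univ_inter, Finset.sum_const, nsmul_one] at hsum
    exact_mod_cast hsum
  · rintro ⟨S, rfl, rfl⟩
    refine ⟨fun i => ?_, by simp⟩
    by_cases h : i ∈ S <;> simp [h]

section Equivalence

variable {n : ℕ} {C A : Matrix (Fin n) (Fin n) ℝ} {t : ℝ}

theorem submatrix_eq_gram (hA : C - t • (1 : Matrix (Fin n) (Fin n) ℝ) = Aᵀ * A)
    (S : Finset (Fin n)) :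
    C.submatrix ((↑) : S → Fin n) ((↑) : S → Fin n) =
      (A.submatrix id ((↑) : S → Fin n))ᵀ * A.submatrix id ((↑) : S → Fin n) +
        t • (1 : Matrix S S ℝ) := by
  ext i j
  conv_lhs => rw [sub_eq_iff_eq_add.1 hA]
  simp only [submatrix_apply, Matrix.add_apply, Matrix.smul_apply, Matrix.mul_apply,
    transpose_apply, Matrix.one_apply, Subtype.ext_iff, id]

theorem eigvals_M_indicator_eq_zero (A : Matrix (Fin n) (Fin n) ℝ) (S : Finset (Fin n))
    {i : Fin n} (hi : ¬ i.val < S.card) :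
    eigvals (M A (fun i => if i ∈ S then 1 else 0)) i = 0 := by
  rw [M_indicator]
  exact eigvals_mul_transpose_eq_zero _ (by simpa using hi)

theorem det_submatrix_eq (hA : C - t • (1 : Matrix (Fin n) (Fin n) ℝ) = Aᵀ * A)
    (S : Finset (Fin n)) :
    (C.submatrix ((↑) : S → Fin n) ((↑) : S → Fin n)).det =
      ∏ i : Fin n with i.val < S.card,
        (eigvals (M A (fun i => if i ∈ S then 1 else 0)) i + t) := by
  have hS : Fintype.card S ≤ n := by simpa using S.card_le_univ
  rw [submatrix_eq_gram hA, det_transpose_mul_add_smul_one _ hS, M_indicator, Fintype.card_coe]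

theorem indicator_nonneg (S : Finset (Fin n)) :
    (0 : Fin n → ℝ) ≤ fun i => if i ∈ S then 1 else 0 := fun i => by
  by_cases h : i ∈ S <;> simp [h]

/-- The factors are nonnegative and their product `det C_SS` is nonzero, which covers `t = 0` too.
-/
theorem eigvals_M_indicator_add_pos (hC : C.PosDef) (ht : 0 ≤ t)
    (hA : C - t • (1 : Matrix (Fin n) (Fin n) ℝ) = Aᵀ * A) (S : Finset (Fin n))
    (i : Fin n) (hi : i.val < S.card) :
    0 < eigvals (M A (fun i => if i ∈ S then 1 else 0)) i + t := by
  have hdet := (hC.submatrix (Subtype.val_injective (p := (· ∈ S)))).det_pos.ne'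
  rw [det_submatrix_eq hA] at hdet
  have hne := Finset.prod_ne_zero_iff.1 hdet i (Finset.mem_filter.2 ⟨Finset.mem_univ i, hi⟩)
  exact lt_of_le_of_ne
    (add_nonneg (eigvals_nonneg (posSemidef_M A (indicator_nonneg S)) i) ht) hne.symm

theorem Phi_M_indicator (hC : C.PosDef) (ht : 0 ≤ t)
    (hA : C - t • (1 : Matrix (Fin n) (Fin n) ℝ) = Aᵀ * A) (S : Finset (Fin n)) :
    Phi S.card t (M A (fun i => if i ∈ S then 1 else 0)) = (logDetSub C S : EReal) := by
  have hpos := eigvals_M_indicator_add_pos hC ht hA S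
  rw [Phi_eq_coe hpos, EReal.coe_eq_coe_iff, logDetSub, det_submatrix_eq hA, Real.log_prod]
  exact fun i hi => (hpos i (Finset.mem_filter.1 hi).2).ne'

theorem PhiHat_M_indicator (hC : C.PosDef) (ht : 0 ≤ t)
    (hA : C - t • (1 : Matrix (Fin n) (Fin n) ℝ) = Aᵀ * A) (S : Finset (Fin n))
    (hS : 1 ≤ S.card) :
    PhiHat S.card t (M A (fun i => if i ∈ S then 1 else 0)) =
      Phi S.card t (M A (fun i => if i ∈ S then 1 else 0)) :=
  PhiHat_eq_Phi hS (by simpa using S.card_le_univ) (posSemidef_M A (indicator_nonneg S))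
    (eigvals_M_indicator_add_pos hC ht hA S) fun _ hi => eigvals_M_indicator_eq_zero A S hi

end Equivalence

end MESP

theorem corollary1 (n s : ℕ) (hs : 1 ≤ s) (hsn : s ≤ n)
    (C : Matrix (Fin n) (Fin n) ℝ) (hC : C.PosDef)
    (t : ℝ) (ht0 : 0 ≤ t) (ht : t ≤ MESP.minEigval C)
    (A : Matrix (Fin n) (Fin n) ℝ) (hA : C - t • (1 : Matrix (Fin n) (Fin n) ℝ) = A.transpose * A) :
    -- the two problems attain the same finite maximum
    (∃ z : ℝ,
      IsGreatest {v : ℝ | ∃ S : Finset (Fin n), S.card = s ∧ v = MESP.logDetSub C S} z ∧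
      IsGreatest {v : EReal | ∃ x ∈ MESP.feasible n s, v = MESP.PhiHat s t (MESP.M A x)}
        (z : EReal)) ∧
    -- corresponding feasible solutions have the same objective value
    (∀ S : Finset (Fin n), S.card = s →
      MESP.PhiHat s t (MESP.M A (fun i => if i ∈ S then 1 else 0)) = (MESP.logDetSub C S : EReal)) ∧
    -- the concave envelope agrees with the function itself at feasible binary points
    (∀ x ∈ MESP.feasible n s,
      MESP.PhiHat s t (MESP.M A x) = MESP.Phi s t (MESP.M A x)) ∧
    -- the objective is a concave function on the unit box, with values in `[-∞, ∞)`
    MESP.EConcaveOn (Set.Icc (0 : Fin n → ℝ) 1) (fun x => MESP.PhiHat s t (MESP.M A x)) ∧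
    (∀ x ∈ Set.Icc (0 : Fin n → ℝ) 1, MESP.PhiHat s t (MESP.M A x) ≠ ⊤) := by
  have hPhi : ∀ S : Finset (Fin n), S.card = s →
      MESP.PhiHat s t (MESP.M A (fun i => if i ∈ S then 1 else 0)) =
        (MESP.logDetSub C S : EReal) := by
    rintro S rfl
    rw [MESP.PhiHat_M_indicator hC ht0 hA S hs, MESP.Phi_M_indicator hC ht0 hA S]
  -- `S₀` shows that the maximum is over a nonempty set, and later supplies the touching point for
  -- the bound below `⊤`.
  obtain ⟨S₀, -, hS₀⟩ := Finset.exists_subset_card_eq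
    (s := (Finset.univ : Finset (Fin n))) (n := s) (by simpa using hsn)
  refine ⟨?_, hPhi, ?_, ?_, ?_⟩
  · obtain ⟨S, hS, hmax⟩ := Finset.exists_max_image
      (Finset.univ.filter fun S : Finset (Fin n) => S.card = s) (MESP.logDetSub C)
      ⟨S₀, by simpa using hS₀⟩
    simp only [Finset.mem_filter, Finset.mem_univ, true_and] at hS hmax
    refine ⟨MESP.logDetSub C S, ⟨⟨S, hS, rfl⟩, ?_⟩,
      ⟨⟨_, MESP.mem_feasible_iff.2 ⟨S, hS, rfl⟩, (hPhi S hS).symm⟩, ?_⟩⟩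
    · rintro _ ⟨T, hT, rfl⟩
      exact hmax T hT
    · rintro _ ⟨x, hx, rfl⟩
      obtain ⟨T, hT, rfl⟩ := MESP.mem_feasible_iff.1 hx
      rw [hPhi T hT]
      exact EReal.coe_le_coe (hmax T hT)
  · intro x hx
    obtain ⟨S, rfl, rfl⟩ := MESP.mem_feasible_iff.1 hx
    exact MESP.PhiHat_M_indicator hC ht0 hA S hs
  · exact (MESP.EConcaveOn.concaveEnvelope (MESP.convex_psdCone n) (MESP.Phi s t)).comp_linearMap
      (convex_Icc _ _) (MESP.linearM A) fun x hx => MESP.posSemidef_M A hx.1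
  · intro x _
    subst hS₀
    exact MESP.PhiHat_ne_top hs hsn (MESP.posSemidef_M A (MESP.indicator_nonneg S₀))
      (MESP.eigvals_M_indicator_add_pos hC ht0 hA S₀)
      (fun _ hi => MESP.eigvals_M_indicator_eq_zero A S₀ hi) _
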